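/- **Theorem (state probabilities of the space-fractional Skellam process).** Let $\lambda_1,\lambda_2>0$ and $\alpha_1,\alpha_2\in(0,1)$. Let $N_1,N_2$ be independent homogeneous Poisson processes with intensities $\lambda_1,\lambda_2$, and let $D_{\alpha_1},D_{\alpha_2}$ be independent stable subordinators with indices $\alpha_1,\alpha_2$, i.e. Lévy processes with non-decreasing paths started at $0$ with $\mathbb E[e^{-sD_{\alpha_i}(t)}]=e^{-ts^{\alpha_i}}$ for $s,t\ge 0$; suppose that the pair $(D_{\alpha_1},D_{\alpha_2})$ is independent of the pair $(N_1,N_2)$. Let $$S_{\alpha_1,\alpha_2}(t)=N_1(D_{\alpha_1}(t))-N_2(D_{\alpha_2}(t)),\qquad t\ge 0,$$ be the space-fractional Skellam process. For $\alpha>0$ and real $b,z$ let $${}_1\psi_1\left[\begin{matrix}(1,\alpha);\\(b,\alpha);\end{matrix}\,z\right]=\sum_{r=0}^{\infty}\frac{\Gamma(1+\alpha r)}{\Gamma(b+\alpha r)}\,\frac{z^r}{r!}$$ be the Fox–Wright function, where $1/\Gamma$ is taken to be $0$ at $0,-1,-2,\dots$. Then for every $t\ge 0$ and every $k\in\mathbb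 Z$ the probability $H_k(t)=\mathbb P(S_{\alpha_1,\alpha_2}(t)=k)$ is given as follows. If $k\ge 0$, $$H_k(t)=\sum_{n=0}^{\infty}\frac{(-1)^{k}}{n!\,(n+k)!}\;{}_1\psi_1\left[\begin{matrix}(1,\alpha_1);\\(1-n-k,\alpha_1);\end{matrix}\,-\lambda_1^{\alpha_1}t\right]\;{}_1\psi_1\left[\begin{matrix}(1,\alpha_2);\\(1-n,\alpha_2);\end{matrix}\,-\lambda_2^{\alpha_2}t\right],$$ and if $k<0$, $$H_k(t)=\sum_{n=0}^{\infty}\frac{(-1)^{|k|}}{n!\,(n+|k|)!}\;{}_1\psi_1\left[\begin{matrix}(1,\alpha_1);\\(1-n,\alpha_1);\end{matrix}\,-\lambda_1^{\alpha_1}t\right]\;{}_1\psi_1\left[\begin{matrix}(1,\alpha_2);\\(1-n-|k|,\alpha_2);\end{matrix}\,-\lambda_2^{\alpha_2}t\right].$$ All the series involved (those over $n$, and the Fox–Wright series defining the factors) converge absolutely. -/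

import Mathlib

open MeasureTheory ProbabilityTheory
open scoped NNReal Nat

noncomputable section

/-- The `r`-th term of the Fox-Wright series with upper parameter pairs `u i = (aᵢ, Aᵢ)` and lower
parameter pairs `v j = (bⱼ, Bⱼ)`. Mathlib's `Real.Gamma` takes the value `0` at `0, -1, -2, …` and
`x / 0 = 0`, so a lower factor at a pole of `Γ` contributes `1 / Γ = 0`, as usual. -/
def foxWrightTerm {p q : ℕ} (u : Fin p → ℝ × ℝ) (v : Fin q → ℝ × ℝ) (z : ℝ) (r : ℕ) : ℝ :=
  (∏ i, Real.Gamma ((u i).1 + (u i).2 * r)) / (∏ j, Real.Gamma ((v j).1 + (v j).2 * r)) *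
    (z ^ r / (r ! : ℝ))

/-- The Fox-Wright function `ₚψ_q` (for real parameters and real argument). -/
def foxWright {p q : ℕ} (u : Fin p → ℝ × ℝ) (v : Fin q → ℝ × ℝ) (z : ℝ) : ℝ :=
  ∑' r : ℕ, foxWrightTerm u v z r

/-- `N` is a homogeneous Poisson process with intensity `l` under `P`. -/
structure IsPoissonProcess {Ω : Type*} [MeasurableSpace Ω] (P : Measure Ω) (l : ℝ≥0)
    (N : ℝ≥0 → Ω → ℕ) : Prop where
  measurable : ∀ t, Measurable (N t)
  zero : ∀ᵐ ω ∂P, N 0 ω = 0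
  mono : ∀ᵐ ω ∂P, Monotone fun t => N t ω
  rightCont : ∀ᵐ ω ∂P, ∀ t, ContinuousWithinAt (fun s => N s ω) (Set.Ici t) t
  indepIncrements : HasIndepIncrements (fun t ω => (N t ω : ℝ)) P
  law_increment : ∀ s t, s ≤ t → HasLaw (fun ω => N t ω - N s ω) (poissonMeasure (l * (t - s))) P

/-- `D` is an `a`-stable subordinator under `P`: a Lévy process with non-decreasing paths, started
at `0`, with Laplace transform `𝔼[exp (-x D(t))] = exp (-t x ^ a)`.
Left limits of the paths exist by monotonicity. -/
structure IsStableSubordinator {Ω : Type*} [MeasurableSpace Ω] (P : Measure Ω) (a : ℝ)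
    (D : ℝ≥0 → Ω → ℝ≥0) : Prop where
  measurable : ∀ t, Measurable (D t)
  zero : ∀ᵐ ω ∂P, D 0 ω = 0
  mono : ∀ᵐ ω ∂P, Monotone fun t => D t ω
  rightCont : ∀ᵐ ω ∂P, ∀ t, ContinuousWithinAt (fun s => D s ω) (Set.Ici t) t
  indepIncrements : HasIndepIncrements (fun t ω => (D t ω : ℝ)) P
  statIncrements : ∀ s t, IdentDistrib (fun ω => (D (s + t) ω : ℝ) - D s ω)
    (fun ω => (D t ω : ℝ)) P P
  laplace : ∀ (t : ℝ≥0) (x : ℝ), 0 ≤ x →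
    ∫ ω, Real.exp (-x * D t ω) ∂P = Real.exp (-t * x ^ a)

/-- The process `S(t) = N₁(D₁(t)) - N₂(D₂(t))`. -/
def timeChangedSkellam {Ω : Type*} (N₁ N₂ : ℝ≥0 → Ω → ℕ) (D₁ D₂ : ℝ≥0 → Ω → ℝ≥0)
    (t : ℝ≥0) (ω : Ω) : ℤ :=
  (N₁ (D₁ t ω) ω : ℤ) - (N₂ (D₂ t ω) ω : ℤ)

/-- `S` is the space-fractional Skellam process built from the Poisson processes `N₁, N₂`
with intensities `l₁, l₂` and the stable subordinators `D₁, D₂` with indices `a₁, a₂`.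
Independence of processes is independence of the whole paths, with the product `σ`-algebra. -/
structure IsSpaceFractionalSkellam {Ω : Type*} [MeasurableSpace Ω] (P : Measure Ω)
    (l₁ l₂ : ℝ≥0) (a₁ a₂ : ℝ) (N₁ N₂ : ℝ≥0 → Ω → ℕ) (D₁ D₂ : ℝ≥0 → Ω → ℝ≥0)
    (S : ℝ≥0 → Ω → ℤ) : Prop where
  poisson₁ : IsPoissonProcess P l₁ N₁
  poisson₂ : IsPoissonProcess P l₂ N₂
  stable₁ : IsStableSubordinator P a₁ D₁
  stable₂ : IsStableSubordinator P a₂ D₂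
  indep_poisson : IndepFun (fun ω s => N₁ s ω) (fun ω s => N₂ s ω) P
  indep_stable : IndepFun (fun ω s => D₁ s ω) (fun ω s => D₂ s ω) P
  indep_poisson_stable : IndepFun (fun ω => ((fun s => N₁ s ω), (fun s => N₂ s ω)))
    (fun ω => ((fun s => D₁ s ω), (fun s => D₂ s ω))) P
  eq : S = timeChangedSkellam N₁ N₂ D₁ D₂

end

/-! ### Fox–Wright series as derivatives of the stable Laplace transform -/

open Filter Topology

/-! Given the subordinators, the two counts are independent Poisson variables. Since `D₁ t` and `D₂
t` are independent too, the probability of the states `(m₁, m₂)` is a product of two factors `𝔼[exp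
(-lD) (lD)^m / m!]` (`measureReal_eq`). Each factor is `(-l)^m / m!` times the `m`-th derivative at
`l` of the Laplace transform `exp (-t x^a) = ∑ (-t)^r x^(ar) / r!`. Termwise differentiation
produces falling factorials of `ar`, which are exactly the Gamma ratios of the Fox–Wright series
(`integral_pow_mul_exp`). Summing over all pairs with `m₁ - m₂ = k` gives the formula, and the terms
are probabilities of disjoint events, so convergence over `n` is absolute. -/

theorem Real.Gamma_one_add_div_Gamma_one_sub_natCast_add {x : ℝ} (hx : 0 ≤ x) (m : ℕ) :
    Real.Gamma (1 + x) / Real.Gamma (1 - m + x) = (descPochhammer ℝ m).eval x := by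
  induction m with
  | zero =>
    have : Real.Gamma (1 + x) ≠ 0 := (Real.Gamma_pos_of_pos (by linarith)).ne'
    simp [this]
  | succ m ih =>
    rw [descPochhammer_succ_right, Polynomial.eval_mul, ← ih]
    have h1 : (1 - ((m + 1 : ℕ) : ℝ) + x) = x - m := by push_cast; ring
    have h2 : (1 - (m : ℝ) + x) = (x - m) + 1 := by ring
    rw [h1, h2]
    simp only [Polynomial.eval_sub, Polynomial.eval_X, Polynomial.eval_natCast]
    by_cases h : x - m = 0
    -- At the first pole both sides vanish: `Γ 0 = 0` by convention, and the new factor `x - m` is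
    -- zero.
    · simp [h, Real.Gamma_zero]
    · rw [Real.Gamma_add_one h, div_mul_eq_mul_div, mul_comm (Real.Gamma (1 + x)),
        mul_div_mul_left _ _ h]

/-- Each of the `m` factors is at most `r + m` in size, and `y^m ≤ m! exp y`. The growth in `r` is
only geometric, so the `1 / r!` of the series beats it. -/
theorem abs_eval_descPochhammer_le {x : ℝ} {r : ℕ} (hx : 0 ≤ x) (hxr : x ≤ r) (m : ℕ) :
    |(descPochhammer ℝ m).eval x| ≤ m ! * Real.exp m * Real.exp 1 ^ r := by
  have h1 : |(descPochhammer ℝ m).eval x| ≤ ((r : ℝ) + m) ^ m := by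
    rw [descPochhammer_eval_eq_prod_range, Finset.abs_prod]
    refine (Finset.prod_le_prod (g := fun _ => (r : ℝ) + m) (fun i _ => abs_nonneg _)
      fun i hi => ?_).trans_eq (by simp)
    have : (i : ℝ) ≤ m := by exact_mod_cast (Finset.mem_range.1 hi).le
    rw [abs_le]
    constructor <;> linarith [Nat.cast_nonneg (α := ℝ) i, Nat.cast_nonneg (α := ℝ) r]
  have h2 := Real.pow_div_factorial_le_exp ((r : ℝ) + m) (by positivity) m
  rw [div_le_iff₀ (by positivity), Real.exp_add] at h2
  have h3 : Real.exp r = Real.exp 1 ^ r := by rw [← Real.exp_nat_mul, mul_one]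
  rw [h3] at h2
  exact h1.trans (h2.trans_eq (by ring))

/-- The `r`-th term of the `m`-th derivative of `x ↦ ∑ r, (-t) ^ r x ^ (a r) / r!`. -/
noncomputable def stableLaplaceTerm (a t : ℝ) (m r : ℕ) (x : ℝ) : ℝ :=
  (-t) ^ r / r ! * (descPochhammer ℝ m).eval (a * r) * x ^ (a * r - m)

theorem hasDerivAt_stableLaplaceTerm (a t : ℝ) (m r : ℕ) {x : ℝ} (hx : 0 < x) :
    HasDerivAt (stableLaplaceTerm a t m r) (stableLaplaceTerm a t (m + 1) r x) x := by
  have h := (Real.hasDerivAt_rpow_const (x := x) (p := a * r - m) (Or.inl hx.ne')).const_mul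
    ((-t) ^ r / r ! * (descPochhammer ℝ m).eval (a * r))
  refine h.congr_deriv ?_
  rw [stableLaplaceTerm, descPochhammer_succ_right, Polynomial.eval_mul]
  simp only [Polynomial.eval_sub, Polynomial.eval_X, Polynomial.eval_natCast]
  have : a * r - ((m + 1 : ℕ) : ℝ) = a * r - m - 1 := by push_cast; ring
  rw [this]
  ring

theorem abs_stableLaplaceTerm_le {a : ℝ} (ha0 : 0 ≤ a) (ha1 : a ≤ 1) (t : ℝ) (m r : ℕ)
    {δ B x : ℝ} (hδ : 0 < δ) (hδx : δ ≤ x) (hxB : x ≤ B) (hB : 1 ≤ B) :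
    |stableLaplaceTerm a t m r x| ≤
      m ! * Real.exp m / δ ^ m * ((|t| * Real.exp 1 * B) ^ r / r !) := by
  have hx : 0 < x := hδ.trans_le hδx
  have har : a * r ≤ r := mul_le_of_le_one_left (Nat.cast_nonneg r) ha1
  have h1 : |x ^ (a * r - m)| ≤ B ^ r / δ ^ m := by
    rw [abs_of_pos (by positivity), Real.rpow_sub hx, Real.rpow_natCast]
    have : x ^ (a * r) ≤ B ^ r := calc
      x ^ (a * r) ≤ B ^ (a * r) := Real.rpow_le_rpow hx.le hxB (by positivity)
      _ ≤ B ^ (r : ℝ) := Real.rpow_le_rpow_of_exponent_le hB har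
      _ = B ^ r := Real.rpow_natCast _ _
    gcongr
  have h2 := abs_eval_descPochhammer_le (by positivity : 0 ≤ a * r) har m
  calc |stableLaplaceTerm a t m r x|
      = |t| ^ r / r ! * |(descPochhammer ℝ m).eval (a * r)| * |x ^ (a * r - m)| := by
        rw [stableLaplaceTerm, abs_mul, abs_mul, abs_div, abs_pow, abs_neg, Nat.abs_cast]
    _ ≤ |t| ^ r / r ! * (m ! * Real.exp m * Real.exp 1 ^ r) * (B ^ r / δ ^ m) := by gcongr
    _ = _ := by rw [mul_pow, mul_pow]; ring

theorem summable_stableLaplaceTerm {a : ℝ} (ha0 : 0 ≤ a) (ha1 : a ≤ 1) (t : ℝ) (m : ℕ) {x : ℝ}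
    (hx : 0 < x) : Summable fun r => stableLaplaceTerm a t m r x :=
  Summable.of_norm_bounded
    ((Real.summable_pow_div_factorial (|t| * Real.exp 1 * (x + 1))).mul_left
      (m ! * Real.exp m / x ^ m))
    fun r => abs_stableLaplaceTerm_le ha0 ha1 t m r hx le_rfl (by linarith) (by linarith)

theorem hasDerivAt_tsum_stableLaplaceTerm {a : ℝ} (ha0 : 0 ≤ a) (ha1 : a ≤ 1) (t : ℝ) (m : ℕ)
    {x : ℝ} (hx : 0 < x) :
    HasDerivAt (fun y => ∑' r, stableLaplaceTerm a t m r y)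
      (∑' r, stableLaplaceTerm a t (m + 1) r x) x := by
  -- The uniform bound needs points bounded away from `0` and an upper bound that is at least `1`.
  have hxm : x ∈ Set.Ioo (x / 2) (x + 1) := ⟨by linarith, by linarith⟩
  refine hasDerivAt_tsum_of_isPreconnected
    ((Real.summable_pow_div_factorial (|t| * Real.exp 1 * (x + 1))).mul_left
      ((m + 1)! * Real.exp (m + 1 : ℕ) / (x / 2) ^ (m + 1))) isOpen_Ioo isPreconnected_Ioo
    (fun r y hy => hasDerivAt_stableLaplaceTerm a t m r ((half_pos hx).trans hy.1))
    (fun r y hy => abs_stableLaplaceTerm_le ha0 ha1 t (m + 1) r (half_pos hx) hy.1.le hy.2.le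
      (by linarith)) hxm (summable_stableLaplaceTerm ha0 ha1 t m hx) hxm

theorem tsum_stableLaplaceTerm_zero (a t : ℝ) {x : ℝ} (hx : 0 < x) :
    ∑' r, stableLaplaceTerm a t 0 r x = Real.exp (-t * x ^ a) := by
  rw [Real.exp_eq_exp_ℝ, NormedSpace.exp_eq_tsum_div]
  refine tsum_congr fun r => ?_
  simp only [stableLaplaceTerm, descPochhammer_zero, Polynomial.eval_one, Nat.cast_zero, sub_zero]
  rw [Real.rpow_mul hx.le, Real.rpow_natCast, mul_pow]
  ring

theorem iteratedDeriv_exp_neg_mul_rpow {a : ℝ} (ha0 : 0 ≤ a) (ha1 : a ≤ 1) (t : ℝ) {f : ℝ → ℝ}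
    (hf : ∀ x, 0 < x → f x = Real.exp (-t * x ^ a)) (m : ℕ) {x : ℝ} (hx : 0 < x) :
    iteratedDeriv m f x = ∑' r, stableLaplaceTerm a t m r x := by
  induction m generalizing x with
  | zero => rw [iteratedDeriv_zero, hf x hx, tsum_stableLaplaceTerm_zero a t hx]
  | succ m ih =>
    rw [iteratedDeriv_succ]
    have h : iteratedDeriv m f =ᶠ[𝓝 x] fun y => ∑' r, stableLaplaceTerm a t m r y := by
      filter_upwards [lt_mem_nhds hx] with y hy using ih hy
    rw [h.deriv_eq, (hasDerivAt_tsum_stableLaplaceTerm ha0 ha1 t m hx).deriv]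

theorem foxWrightTerm_eq_stableLaplaceTerm {a : ℝ} (ha : 0 ≤ a) (t : ℝ) (m r : ℕ) {l : ℝ}
    (hl : 0 < l) :
    foxWrightTerm ![(1, a)] ![(1 - (m : ℝ), a)] (-l ^ a * t) r =
      l ^ m * stableLaplaceTerm a t m r l := by
  simp only [foxWrightTerm, Finset.univ_unique, Fin.default_eq_zero, Finset.prod_singleton,
    Matrix.cons_val_fin_one, stableLaplaceTerm]
  rw [Real.Gamma_one_add_div_Gamma_one_sub_natCast_add (by positivity), Real.rpow_sub hl,
    Real.rpow_mul hl.le, Real.rpow_natCast, Real.rpow_natCast]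
  have : l ^ m ≠ 0 := by positivity
  have h : -l ^ a * t = -t * l ^ a := by ring
  rw [h, mul_pow]
  field_simp

theorem summable_foxWrightTerm {a : ℝ} (ha : a ∈ Set.Ioo (0 : ℝ) 1) (t : ℝ) (m : ℕ) {l : ℝ}
    (hl : 0 < l) :
    Summable (foxWrightTerm ![(1, a)] ![(1 - (m : ℝ), a)] (-l ^ a * t)) := by
  simp_rw [funext fun r => foxWrightTerm_eq_stableLaplaceTerm ha.1.le t m r hl]
  exact (summable_stableLaplaceTerm ha.1.le ha.2.le t m hl).mul_left _

theorem IsStableSubordinator.integral_pow_mul_exp {Ω : Type*} [MeasurableSpace Ω] {P : Measure Ω}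
    [IsProbabilityMeasure P] {a : ℝ} {D : ℝ≥0 → Ω → ℝ≥0} (hD : IsStableSubordinator P a D)
    (ha : a ∈ Set.Ioo (0 : ℝ) 1) (t : ℝ≥0) {l : ℝ} (hl : 0 < l) (m : ℕ) :
    -- The derivatives of the moment generating function of `-D t` supply the moments `𝔼[(-D)^m exp
    -- (-lD)]`; `l > 0` is interior to its domain.
    ∫ ω, Real.exp (-(l * D t ω)) * (l * D t ω) ^ m / (m ! : ℝ) ∂P =
      (-1) ^ m / m ! * foxWright ![(1, a)] ![(1 - (m : ℝ), a)] (-l ^ a * t) := by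
  have hm : mgf (fun ω => -(D t ω : ℝ)) P = fun x => ∫ ω, Real.exp (-x * D t ω) ∂P := by
    ext x; simp [mgf]
  have hintegral : Set.Ioi (0 : ℝ) ⊆ integrableExpSet (fun ω => -(D t ω : ℝ)) P := by
    intro x hx
    refine Integrable.of_bound (C := 1) ?_ (ae_of_all _ fun ω => ?_)
    · have := hD.measurable t
      exact Measurable.aestronglyMeasurable (by fun_prop)
    · rw [Real.norm_eq_abs, Real.abs_exp, Real.exp_le_one_iff]
      have : 0 ≤ x * D t ω := mul_nonneg (le_of_lt hx) (NNReal.coe_nonneg _)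
      linarith
  have hl' : l ∈ interior (integrableExpSet (fun ω => -(D t ω : ℝ)) P) :=
    mem_interior.2 ⟨_, hintegral, isOpen_Ioi, hl⟩
  have h := iteratedDeriv_mgf hl' m
  rw [iteratedDeriv_exp_neg_mul_rpow ha.1.le ha.2.le t
    (fun x hx => by rw [hm]; exact hD.laplace t x hx.le) m hl] at h
  rw [foxWright, tsum_congr fun r => foxWrightTerm_eq_stableLaplaceTerm ha.1.le t m r hl,
    tsum_mul_left, h, ← integral_const_mul, ← integral_const_mul]
  congr 1 with ω
  have h1 : (-1 : ℝ) ^ m * (-1) ^ m = 1 := by rw [← mul_pow]; simp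
  rw [neg_pow (D t ω : ℝ), mul_pow, mul_neg]
  linear_combination (-(Real.exp (-(l * D t ω)) * l ^ m * (D t ω : ℝ) ^ m / m !)) * h1

/-! ### Counting paths evaluated at a random time -/

open scoped ENNReal

theorem ProbabilityTheory.IndepFun.measure_pair_mem {Ω α β : Type*} [MeasurableSpace Ω]
    [MeasurableSpace α] [MeasurableSpace β] {P : Measure Ω} [IsFiniteMeasure P] {X : Ω → α}
    {Y : Ω → β} (h : IndepFun X Y P) (hX : Measurable X) (hY : Measurable Y) {s : Set (α × β)}
    (hs : MeasurableSet s) :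
    P {ω | (X ω, Y ω) ∈ s} = ∫⁻ ω, P {ω' | (X ω', Y ω) ∈ s} ∂P := by
  have h1 := (indepFun_iff_map_prod_eq_prod_map_map hX.aemeasurable hY.aemeasurable).1 h
  calc P {ω | (X ω, Y ω) ∈ s} = P.map (fun ω => (X ω, Y ω)) s :=
        (Measure.map_apply (hX.prodMk hY) hs).symm
    _ = ∫⁻ ω, P.map X ((fun x => (x, Y ω)) ⁻¹' s) ∂P := by
        rw [h1, Measure.prod_apply_symm hs, lintegral_map (measurable_measure_prodMk_right hs) hY]
    _ = _ := by
        refine lintegral_congr fun ω => ?_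
        rw [Measure.map_apply hX (measurable_prodMk_right hs)]
        rfl

/-- The approximation of `d` from the right by a multiple of `1 / (j + 1)`. -/
noncomputable def rightApprox (j : ℕ) (d : ℝ≥0) : ℝ≥0 := (⌊(j + 1) * d⌋₊ + 1) / (j + 1)

theorem le_rightApprox (j : ℕ) (d : ℝ≥0) : d ≤ rightApprox j d := by
  rw [rightApprox, le_div_iff₀ (by positivity), mul_comm]
  exact (Nat.lt_floor_add_one _).le

theorem rightApprox_le (j : ℕ) (d : ℝ≥0) : rightApprox j d ≤ d + 1 / (j + 1) := by
  rw [rightApprox, div_le_iff₀ (by positivity), add_mul d, div_mul_cancel₀ _ (by positivity),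
    mul_comm d]
  gcongr
  exact Nat.floor_le (by positivity)

theorem tendsto_rightApprox (d : ℝ≥0) :
    Tendsto (fun j => rightApprox j d) atTop (𝓝[≥] d) := by
  refine tendsto_nhdsWithin_iff.2 ⟨?_, Eventually.of_forall fun j => le_rightApprox j d⟩
  have h : Tendsto (fun j : ℕ => d + 1 / ((j : ℝ≥0) + 1)) atTop (𝓝 (d + 0)) :=
    tendsto_const_nhds.add tendsto_one_div_add_atTop_nhds_zero_nat
  rw [add_zero] at h
  exact tendsto_of_tendsto_of_tendsto_of_le_of_le tendsto_const_nhds h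
    (fun j => le_rightApprox j d) (fun j => rightApprox_le j d)

/-- A jointly measurable evaluation of counting paths, which agrees with the usual evaluation on
right-continuous paths. -/
noncomputable def evalRight (p : (ℝ≥0 → ℕ) × ℝ≥0) : ℝ≥0∞ :=
  limsup (fun j => (p.1 (rightApprox j p.2) : ℝ≥0∞)) atTop

/-- For fixed `j` the sampling time depends on `d` only through a natural number, so joint
measurability reduces to countably many coordinate maps. -/
theorem measurable_evalRight : Measurable evalRight := by
  refine Measurable.limsup fun j => ?_
  have h1 : Measurable fun q : (ℝ≥0 → ℕ) × ℕ => (q.1 ((q.2 + 1) / (j + 1)) : ℝ≥0∞) :=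
    measurable_from_prod_countable_left fun i =>
      (measurable_of_countable _).comp (measurable_pi_apply ((i + 1) / (j + 1) : ℝ≥0))
  have h2 : Measurable fun p : (ℝ≥0 → ℕ) × ℝ≥0 => (p.1, ⌊(j + 1) * p.2⌋₊) := by fun_prop
  exact h1.comp h2

theorem evalRight_eq {n : ℝ≥0 → ℕ} {d : ℝ≥0} (h : ContinuousWithinAt n (Set.Ici d) d) :
    evalRight (n, d) = n d := by
  have h1 : ∀ᶠ j in atTop, n (rightApprox j d) = n d :=
    (h.tendsto.comp (tendsto_rightApprox d)).eventually
      ((isOpen_discrete {n d}).mem_nhds rfl)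
  have h2 : (fun j => (n (rightApprox j d) : ℝ≥0∞)) =ᶠ[atTop] fun _ => (n d : ℝ≥0∞) :=
    h1.mono fun j hj => by simp only [hj]
  rw [evalRight, limsup_congr h2, limsup_const]

namespace IsPoissonProcess

variable {Ω : Type*} [MeasurableSpace Ω] {P : Measure Ω} {l : ℝ≥0} {N : ℝ≥0 → Ω → ℕ}

theorem evalRight_ae_eq (hN : IsPoissonProcess P l N) :
    ∀ᵐ ω ∂P, ∀ d, evalRight (fun s => N s ω, d) = N d ω := by
  filter_upwards [hN.rightCont] with ω hω d using evalRight_eq (hω d)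

theorem measure_eq (hN : IsPoissonProcess P l N) (d : ℝ≥0) (m : ℕ) :
    P {ω | N d ω = m} = ENNReal.ofReal (Real.exp (-(l * d)) * (l * d) ^ m / (m ! : ℝ)) := by
  have h := (hN.law_increment 0 d zero_le).measure_eq (p := fun n => n = m)
    (MeasurableSet.of_discrete)
  have h1 : P {ω | N d ω = m} = P {ω | N d ω - N 0 ω = m} := by
    refine measure_congr ?_
    filter_upwards [hN.zero] with ω hω
    change (N d ω = m) = (N d ω - N 0 ω = m)
    rw [hω, Nat.sub_zero]
  rw [h1, h, tsub_zero, Set.ofPred_eq_eq_singleton, poissonMeasure_singleton]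
  push_cast
  rfl

end IsPoissonProcess

/-! ### Joint law of the time-changed processes and summation over a diagonal -/

namespace IsSpaceFractionalSkellam

variable {Ω : Type*} [MeasurableSpace Ω] {P : Measure Ω}
  {l₁ l₂ : ℝ≥0} {a₁ a₂ : ℝ} {N₁ N₂ : ℝ≥0 → Ω → ℕ} {D₁ D₂ : ℝ≥0 → Ω → ℝ≥0} {S : ℝ≥0 → Ω → ℤ}

theorem nullMeasurableSet_eq (hS : IsSpaceFractionalSkellam P l₁ l₂ a₁ a₂ N₁ N₂ D₁ D₂ S)
    (t : ℝ≥0) (m₁ m₂ : ℕ) :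
    NullMeasurableSet {ω | N₁ (D₁ t ω) ω = m₁ ∧ N₂ (D₂ t ω) ω = m₂} P := by
  have aux {l : ℝ≥0} {a : ℝ} {N : ℝ≥0 → Ω → ℕ} {D : ℝ≥0 → Ω → ℝ≥0} (hN : IsPoissonProcess P l N)
      (hD : IsStableSubordinator P a D) (m : ℕ) :
      NullMeasurableSet {ω | N (D t ω) ω = m} P := by
    have h1 : Measurable fun ω => evalRight (fun s => N s ω, D t ω) :=
      measurable_evalRight.comp ((measurable_pi_lambda _ hN.measurable).prodMk (hD.measurable t))
    refine (h1 (measurableSet_singleton (m : ℝ≥0∞))).nullMeasurableSet.congr ?_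
    filter_upwards [hN.evalRight_ae_eq] with ω hω
    change (evalRight (fun s => N s ω, D t ω) = m) = (N (D t ω) ω = m)
    rw [hω, Nat.cast_inj]
  exact (aux hS.poisson₁ hS.stable₁ m₁).inter (aux hS.poisson₂ hS.stable₂ m₂)

theorem measure_eq_lintegral [IsProbabilityMeasure P]
    (hS : IsSpaceFractionalSkellam P l₁ l₂ a₁ a₂ N₁ N₂ D₁ D₂ S)
    (t : ℝ≥0) (m₁ m₂ : ℕ) :
    P {ω | N₁ (D₁ t ω) ω = m₁ ∧ N₂ (D₂ t ω) ω = m₂} =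
      ∫⁻ ω, P {ω' | N₁ (D₁ t ω) ω' = m₁} * P {ω' | N₂ (D₂ t ω) ω' = m₂} ∂P := by
  have hind : IndepFun (fun ω => ((fun s => N₁ s ω), (fun s => N₂ s ω)))
      (fun ω => (D₁ t ω, D₂ t ω)) P :=
    hS.indep_poisson_stable.comp measurable_id
      (((measurable_pi_apply t).comp measurable_fst).prodMk
        ((measurable_pi_apply t).comp measurable_snd))
  have hmN : Measurable fun ω => ((fun s => N₁ s ω), (fun s => N₂ s ω)) :=
    (measurable_pi_lambda _ hS.poisson₁.measurable).prodMk
      (measurable_pi_lambda _ hS.poisson₂.measurable)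
  have hmD : Measurable fun ω => (D₁ t ω, D₂ t ω) :=
    (hS.stable₁.measurable t).prodMk (hS.stable₂.measurable t)
  -- Evaluation through `evalRight` makes this set product-measurable, so Fubini applies.
  let s : Set (((ℝ≥0 → ℕ) × (ℝ≥0 → ℕ)) × (ℝ≥0 × ℝ≥0)) :=
    {p | evalRight (p.1.1, p.2.1) = m₁ ∧ evalRight (p.1.2, p.2.2) = m₂}
  have hs : MeasurableSet s := by
    refine MeasurableSet.inter (measurableSet_eq_fun ?_ measurable_const)
      (measurableSet_eq_fun ?_ measurable_const) <;>
    exact measurable_evalRight.comp (by fun_prop)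
  -- This covers both the random times `(D₁ t ω, D₂ t ω)` before conditioning and the frozen times
  -- after it.
  have hae : ∀ X : Ω → Ω → ℝ≥0 × ℝ≥0,
      P {ω | N₁ (X ω ω).1 ω = m₁ ∧ N₂ (X ω ω).2 ω = m₂} =
      P {ω | (((fun s => N₁ s ω), (fun s => N₂ s ω)), X ω ω) ∈ s} := by
    intro X
    refine measure_congr ?_
    filter_upwards [hS.poisson₁.evalRight_ae_eq, hS.poisson₂.evalRight_ae_eq] with ω h1 h2
    change (N₁ (X ω ω).1 ω = m₁ ∧ N₂ (X ω ω).2 ω = m₂) =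
      (evalRight (fun s => N₁ s ω, (X ω ω).1) = m₁ ∧ evalRight (fun s => N₂ s ω, (X ω ω).2) = m₂)
    rw [h1, h2, Nat.cast_inj, Nat.cast_inj]
  rw [hae fun ω _ => (D₁ t ω, D₂ t ω), hind.measure_pair_mem hmN hmD hs]
  refine lintegral_congr fun ω => ?_
  rw [← hae fun _ _ => (D₁ t ω, D₂ t ω)]
  have h := hS.indep_poisson.comp (measurable_pi_apply (D₁ t ω)) (measurable_pi_apply (D₂ t ω))
  exact h.measure_inter_preimage_eq_mul {m₁} {m₂} (measurableSet_singleton _)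
    (measurableSet_singleton _)

theorem measureReal_eq [IsProbabilityMeasure P]
    (hS : IsSpaceFractionalSkellam P l₁ l₂ a₁ a₂ N₁ N₂ D₁ D₂ S)
    (hl₁ : 0 < l₁) (hl₂ : 0 < l₂) (ha₁ : a₁ ∈ Set.Ioo (0 : ℝ) 1) (ha₂ : a₂ ∈ Set.Ioo (0 : ℝ) 1)
    (t : ℝ≥0) (m₁ m₂ : ℕ) :
    P.real {ω | N₁ (D₁ t ω) ω = m₁ ∧ N₂ (D₂ t ω) ω = m₂} =
      ((-1) ^ m₁ / m₁ ! * foxWright ![(1, a₁)] ![(1 - (m₁ : ℝ), a₁)] (-l₁ ^ a₁ * t)) *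
      ((-1) ^ m₂ / m₂ ! * foxWright ![(1, a₂)] ![(1 - (m₂ : ℝ), a₂)] (-l₂ ^ a₂ * t)) := by
  rw [← hS.stable₁.integral_pow_mul_exp ha₁ t (NNReal.coe_pos.2 hl₁),
    ← hS.stable₂.integral_pow_mul_exp ha₂ t (NNReal.coe_pos.2 hl₂), measureReal_def,
    hS.measure_eq_lintegral]
  simp_rw [hS.poisson₁.measure_eq, hS.poisson₂.measure_eq]
  have hm (l : ℝ≥0) (m : ℕ) : Measurable fun x : ℝ≥0 =>
      Real.exp (-(l * x)) * (l * x) ^ m / (m ! : ℝ) := by fun_prop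
  have hD := hS.indep_stable.comp (measurable_pi_apply t) (measurable_pi_apply t)
  have hi := hD.comp (hm l₁ m₁).ennreal_ofReal (hm l₂ m₂).ennreal_ofReal
  have hprod := lintegral_mul_eq_lintegral_mul_lintegral_of_indepFun
    ((hm l₁ m₁).ennreal_ofReal.comp (hS.stable₁.measurable t))
    ((hm l₂ m₂).ennreal_ofReal.comp (hS.stable₂.measurable t)) hi
  have hintegral {D : ℝ≥0 → Ω → ℝ≥0} (hD : Measurable (D t)) (l : ℝ≥0) (m : ℕ) :
      (∫⁻ ω, ENNReal.ofReal (Real.exp (-(l * D t ω)) * (l * D t ω) ^ m / (m ! : ℝ)) ∂P).toReal =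
      ∫ ω, Real.exp (-(l * D t ω)) * (l * D t ω) ^ m / (m ! : ℝ) ∂P :=
    (integral_eq_lintegral_of_nonneg_ae
      (ae_of_all _ fun ω => show 0 ≤ Real.exp _ * _ / _ by positivity)
      ((hm l m).comp hD).aestronglyMeasurable).symm
  rw [← hintegral (hS.stable₁.measurable t), ← hintegral (hS.stable₂.measurable t), ← ENNReal.toReal_mul]
  exact congrArg ENNReal.toReal hprod

/-- If `f` enumerates the pairs of states with difference `k`, the probability of `S t = k` is the
sum of the probabilities of these pairs. -/
theorem hasSum_measureReal [IsProbabilityMeasure P]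
    (hS : IsSpaceFractionalSkellam P l₁ l₂ a₁ a₂ N₁ N₂ D₁ D₂ S)
    (t : ℝ≥0) {k : ℤ} {f : ℕ → ℕ × ℕ} (hf : Function.Injective f)
    (hk : ∀ p : ℕ × ℕ, (p.1 : ℤ) - p.2 = k ↔ p ∈ Set.range f) :
    HasSum (fun n => P.real {ω | N₁ (D₁ t ω) ω = (f n).1 ∧ N₂ (D₂ t ω) ω = (f n).2})
      (P.real {ω | S t ω = k}) := by
  have hset : {ω | S t ω = k} =
      ⋃ n, {ω | N₁ (D₁ t ω) ω = (f n).1 ∧ N₂ (D₂ t ω) ω = (f n).2} := by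
    ext ω
    rw [Set.mem_iUnion, Set.mem_ofPred_eq, hS.eq]
    refine (hk (N₁ (D₁ t ω) ω, N₂ (D₂ t ω) ω)).trans (exists_congr fun n => ?_)
    rw [Prod.ext_iff, eq_comm, eq_comm (a := (f n).2)]
    rfl
  have hd : Pairwise (Function.onFun (AEDisjoint P)
      fun n => {ω | N₁ (D₁ t ω) ω = (f n).1 ∧ N₂ (D₂ t ω) ω = (f n).2}) := by
    intro i j hij
    refine (Set.disjoint_left.2 fun ω hi hj => hij (hf ?_)).aedisjoint
    exact Prod.ext (hi.1.symm.trans hj.1) (hi.2.symm.trans hj.2)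
  have hsum := measure_iUnion₀ hd fun n => hS.nullMeasurableSet_eq t (f n).1 (f n).2
  rw [← hset] at hsum
  have hne : ∑' n, P {ω | N₁ (D₁ t ω) ω = (f n).1 ∧ N₂ (D₂ t ω) ω = (f n).2} ≠ ∞ :=
    hsum ▸ measure_ne_top P _
  rw [measureReal_def, hsum, ENNReal.tsum_toReal_eq (ENNReal.ne_top_of_tsum_ne_top hne)]
  exact ENNReal.hasSum_toReal hne

end IsSpaceFractionalSkellam

theorem mainTheorem4 {Ω : Type*} [MeasurableSpace Ω] (P : Measure Ω) [IsProbabilityMeasure P]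
    (l₁ l₂ : ℝ≥0) (hl₁ : 0 < l₁) (hl₂ : 0 < l₂)
    (a₁ a₂ : ℝ) (ha₁ : a₁ ∈ Set.Ioo (0 : ℝ) 1) (ha₂ : a₂ ∈ Set.Ioo (0 : ℝ) 1)
    (N₁ N₂ : ℝ≥0 → Ω → ℕ) (D₁ D₂ : ℝ≥0 → Ω → ℝ≥0) (S : ℝ≥0 → Ω → ℤ)
    (hS : IsSpaceFractionalSkellam P l₁ l₂ a₁ a₂ N₁ N₂ D₁ D₂ S) (t : ℝ≥0) :
    -- the Fox-Wright series that occur below converge absolutely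
    (∀ m : ℕ,
      Summable (foxWrightTerm ![(1, a₁)] ![(1 - (m : ℝ), a₁)] (-(l₁ : ℝ) ^ a₁ * t)) ∧
      Summable (foxWrightTerm ![(1, a₂)] ![(1 - (m : ℝ), a₂)] (-(l₂ : ℝ) ^ a₂ * t))) ∧
    ∀ k : ℤ,
      (0 ≤ k → HasSum (fun n : ℕ =>
        (-1 : ℝ) ^ k.natAbs / ((n ! : ℝ) * ((n + k.natAbs)! : ℝ)) *
          foxWright ![(1, a₁)] ![(1 - (n : ℝ) - (k : ℝ), a₁)] (-(l₁ : ℝ) ^ a₁ * t) *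
          foxWright ![(1, a₂)] ![(1 - (n : ℝ), a₂)] (-(l₂ : ℝ) ^ a₂ * t))
        (P.real {ω | S t ω = k})) ∧
      (k < 0 → HasSum (fun n : ℕ =>
        (-1 : ℝ) ^ k.natAbs / ((n ! : ℝ) * ((n + k.natAbs)! : ℝ)) *
          foxWright ![(1, a₁)] ![(1 - (n : ℝ), a₁)] (-(l₁ : ℝ) ^ a₁ * t) *
          foxWright ![(1, a₂)] ![(1 - (n : ℝ) - |(k : ℝ)|, a₂)] (-(l₂ : ℝ) ^ a₂ * t))
        (P.real {ω | S t ω = k})) := by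
  refine ⟨fun m => ⟨summable_foxWrightTerm ha₁ t m (NNReal.coe_pos.2 hl₁),
    summable_foxWrightTerm ha₂ t m (NNReal.coe_pos.2 hl₂)⟩, fun k => ⟨fun hk => ?_, fun hk => ?_⟩⟩
  · lift k to ℕ using hk
    convert hS.hasSum_measureReal t (k := k) (f := fun n => (n + k, n))
      (fun i j h => congrArg Prod.snd h) ?_ using 2 with n
    · rw [hS.measureReal_eq hl₁ hl₂ ha₁ ha₂, Int.natAbs_natCast]
      have h : 1 - (n : ℝ) - ((k : ℤ) : ℝ) = 1 - ((n + k : ℕ) : ℝ) := by push_cast; ring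
      -- The signs of the two factors, `(-1)^(n+k)` and `(-1)^n`, combine to `(-1)^k`.
      have h1 : (-1 : ℝ) ^ n * (-1) ^ n = 1 := by rw [← mul_pow]; simp
      rw [h, pow_add]
      generalize foxWright _ _ _ = A
      generalize foxWright _ _ _ = B
      linear_combination (-((-1) ^ k / ((n ! : ℝ) * ((n + k)! : ℝ)) * A * B)) * h1
    · rintro ⟨x, y⟩
      simp only [Set.mem_range, Prod.mk.injEq]
      constructor
      · intro h; exact ⟨y, by omega, rfl⟩
      · rintro ⟨n, h, rfl⟩; omega
  · obtain ⟨j, rfl⟩ : ∃ j : ℕ, k = -(j : ℤ) := ⟨k.natAbs, by omega⟩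
    convert hS.hasSum_measureReal t (k := -(j : ℤ)) (f := fun n => (n, n + j))
      (fun i j h => congrArg Prod.fst h) ?_ using 2 with n
    · rw [hS.measureReal_eq hl₁ hl₂ ha₁ ha₂, Int.natAbs_neg, Int.natAbs_natCast]
      have h : 1 - (n : ℝ) - |((-(j : ℤ) : ℤ) : ℝ)| = 1 - ((n + j : ℕ) : ℝ) := by
        push_cast; rw [abs_neg, Nat.abs_cast]; ring
      have h1 : (-1 : ℝ) ^ n * (-1) ^ n = 1 := by rw [← mul_pow]; simp
      rw [h, pow_add]
      generalize foxWright _ _ _ = A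
      generalize foxWright _ _ _ = B
      linear_combination (-((-1) ^ j / ((n ! : ℝ) * ((n + j)! : ℝ)) * A * B)) * h1
    · rintro ⟨x, y⟩
      simp only [Set.mem_range, Prod.mk.injEq]
      constructor
      · intro h; exact ⟨x, rfl, by omega⟩
      · rintro ⟨n, rfl, h⟩; omega
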